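/- Let $A\in\mathbb{R}^{n\times m}$ and denote all its nonzero singular values (with multiplicity) by $\sigma_1(A)\ge\dots\ge\sigma_{\operatorname{rank}(A)}(A)>0$. Let $W\in\mathbb{R}^{m\times m}$ be a diagonal matrix whose diagonal entries are all nonzero. Then for all integers $k,r$ with $1\le k\le r\le\operatorname{rank}(A)$ there exists a subset $\mathcal S\subseteq\{1,\dots,m\}$ of size $k$ such that $$\sigma_{\min}(A_{\mathcal S}W_{\mathcal S})^2\;\ge\;\frac{(\sqrt r-\sqrt{k-1})^2}{\|W^{-1}\|_F^2}\cdot\frac{r}{\sum_{i=1}^{r}\sigma_i(A)^{-2}}.$$ Here $A_{\mathcal S}$ is the $n\times k$ submatrix of $A$ formed by the columns indexed by $\mathcal S$, $W_{\mathcal S}$ is the $k\times k$ diagonal submatrix of $W$ with rows and columns indexed by $\mathcal S$, $\sigma_{\min}(B)=\min_{\|x\|_2=1}\|Bx\|_2$ is the least singular value, and $\|\cdot\|_F$ is the Frobenius norm. -/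

import Mathlib

noncomputable section

namespace RestrictedInvertibility

/-- `σ_i(A)`, the `i`-th largest singular value of a real matrix `A` acting between Euclidean
spaces, with multiplicity and indexed from `0`; the first `rank A` of them are the nonzero ones. -/
def singularValue {n m : ℕ} (A : Matrix (Fin n) (Fin m) ℝ) (i : ℕ) : ℝ :=
  (Matrix.toEuclideanLin A).singularValues i

/-- The least singular value `σ_min(B) = min_{‖x‖₂ = 1} ‖B x‖₂`. The minimum is attained, by
compactness of the unit sphere, whenever `B` has at least one column. -/
def sigmaMin {m ι : Type*} [Fintype m] [Fintype ι] [DecidableEq ι] (B : Matrix m ι ℝ) : ℝ :=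
  ⨅ x : Metric.sphere (0 : EuclideanSpace ℝ ι) 1, ‖Matrix.toEuclideanLin B x‖

/-- `A_S`: the columns of `A` indexed by `S`. -/
def columns {n m : ℕ} (A : Matrix (Fin n) (Fin m) ℝ) (S : Finset (Fin m)) :
    Matrix (Fin n) S ℝ :=
  A.submatrix id Subtype.val

/-- `W_S`: the principal submatrix of a square matrix with rows and columns indexed by `S`. -/
def principal {m : ℕ} (W : Matrix (Fin m) (Fin m) ℝ) (S : Finset (Fin m)) : Matrix S S ℝ :=
  W.submatrix Subtype.val Subtype.val

open scoped Matrix.Norms.Frobenius in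
/-- The Frobenius norm of a real matrix. -/
def frobeniusNorm {n m : ℕ} (A : Matrix (Fin n) (Fin m) ℝ) : ℝ := ‖A‖

end RestrictedInvertibility

end

/-
Let `χ` be the characteristic polynomial of a real symmetric matrix and `D` differentiation.
Averaging over rank-one updates `u uᵀ` with `𝔼[u uᵀ] = 1` turns `χ` into `(1 - D) χ`. Here `u`
holds the coordinates, with respect to the top `r` right singular vectors of `A`, of a rescaled
column of `W`, the `a`-th one being drawn with probability proportional to `1 / W a a ^ 2`. One
starts from `-diag ν`, with `ν i` a multiple of `1 / σ_i(A) ^ 2`, and chooses updates greedily,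
each preserving the sign of `((1 - D) ^ l χ)(0)`, where `l` is the number of updates to come.
A rank-one update and the operator `1 - D` each raise the number of positive roots by at most one,
so this sign, a parity, forces the `k` chosen updates to produce exactly `k` positive eigenvalues;
no interlacing families are needed. By Cauchy–Schwarz, `k` positive eigenvalues of
`-diag ν + ∑ u uᵀ` yield the lower bound on `σ_min`.

The sign at the start comes from the duality
`((1 - D) ^ j ∏ᵢ (X + ν i))(0) = (∏ᵢ (ν i - D) X ^ j)(1)`: a barrier argument shows that applying
the operators `ν i - D` to `X ^ j` pushes all roots beyond `1`.
-/

namespace RestrictedInvertibility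

open Matrix Polynomial

section QuadraticForm

variable {ι : Type*} [Fintype ι] [DecidableEq ι] {A B : Matrix ι ι ℝ}

theorem exists_linearEquiv_dotProduct_mulVec_eq_sum (hA : A.IsHermitian) :
    ∃ e : (ι → ℝ) ≃ₗ[ℝ] (ι → ℝ), (∀ x, x ⬝ᵥ x = ∑ i, e x i ^ 2) ∧
      ∀ x, x ⬝ᵥ (A *ᵥ x) = ∑ i, hA.eigenvalues i * e x i ^ 2 := by
  let b := hA.eigenvectorBasis
  have dotProduct_eq (x y : ι → ℝ) :
      x ⬝ᵥ y = ∑ i, b.repr (WithLp.toLp 2 x) i * b.repr (WithLp.toLp 2 y) i := by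
    calc x ⬝ᵥ y = inner ℝ (WithLp.toLp 2 x) (WithLp.toLp 2 y) := by
          rw [EuclideanSpace.inner_toLp_toLp, star_trivial, dotProduct_comm]
      _ = inner ℝ (b.repr (WithLp.toLp 2 x)) (b.repr (WithLp.toLp 2 y)) :=
          (b.repr.inner_map_map _ _).symm
      _ = _ := by simp only [PiLp.inner_apply, RCLike.inner_apply, conj_trivial, mul_comm]
  have repr_mulVec (x : ι → ℝ) (i : ι) : b.repr (WithLp.toLp 2 (A *ᵥ x)) i =
      hA.eigenvalues i * b.repr (WithLp.toLp 2 x) i := by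
    have hsymm := isSymmetric_toEuclideanLin_iff.2 hA (b i) (WithLp.toLp 2 x)
    have heig : toEuclideanLin A (b i) = hA.eigenvalues i • b i :=
      PiLp.ext fun j => congrFun (hA.mulVec_eigenvectorBasis i) j
    rw [heig, inner_smul_left] at hsymm
    simpa [OrthonormalBasis.repr_apply_apply] using hsymm.symm
  refine ⟨(WithLp.linearEquiv 2 ℝ (ι → ℝ)).symm ≪≫ₗ b.repr.toLinearEquiv ≪≫ₗ
    WithLp.linearEquiv 2 ℝ (ι → ℝ), fun x => ?_, fun x => ?_⟩
  · simpa [sq] using dotProduct_eq x x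
  · simp only [dotProduct_eq, repr_mulVec]
    refine Finset.sum_congr rfl fun i _ => ?_
    change b.repr (WithLp.toLp 2 x) i * (hA.eigenvalues i * b.repr (WithLp.toLp 2 x) i) =
      hA.eigenvalues i * b.repr (WithLp.toLp 2 x) i ^ 2
    ring

theorem exists_linearMap_lt_dotProduct_mulVec (hA : A.IsHermitian) (t : ℝ) :
    ∃ g : ({i // t < hA.eigenvalues i} → ℝ) →ₗ[ℝ] ι → ℝ,
      ∀ z ≠ 0, t * (g z ⬝ᵥ g z) < g z ⬝ᵥ (A *ᵥ g z) := by
  obtain ⟨e, he, heA⟩ := exists_linearEquiv_dotProduct_mulVec_eq_sum hA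
  refine ⟨e.symm.toLinearMap ∘ₗ Function.ExtendByZero.linearMap ℝ Subtype.val, fun z hz => ?_⟩
  obtain ⟨i, hi⟩ := Function.ne_iff.1 hz
  have extend_apply (j : {i // t < hA.eigenvalues i}) :
      Function.extend Subtype.val z 0 j.1 = z j := Subtype.val_injective.extend_apply _ _ _
  simp only [he, heA, Finset.mul_sum, LinearMap.comp_apply, LinearEquiv.coe_coe,
    LinearEquiv.apply_symm_apply, Function.ExtendByZero.linearMap_apply]
  refine Finset.sum_lt_sum (fun j _ => ?_) ⟨i, Finset.mem_univ _, ?_⟩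
  · by_cases hj : t < hA.eigenvalues j
    · gcongr
    · rw [Function.extend_apply' _ _ _ (by simpa using hj)]
      simp
  · rw [extend_apply]
    have := sq_pos_of_ne_zero hi
    exact mul_lt_mul_of_pos_right i.2 this

theorem exists_linearMap_dotProduct_mulVec_le (hA : A.IsHermitian) (t : ℝ) :
    ∃ h : (ι → ℝ) →ₗ[ℝ] ({i // t < hA.eigenvalues i} → ℝ),
      ∀ x, h x = 0 → x ⬝ᵥ (A *ᵥ x) ≤ t * (x ⬝ᵥ x) := by
  obtain ⟨e, he, heA⟩ := exists_linearEquiv_dotProduct_mulVec_eq_sum hA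
  refine ⟨LinearMap.funLeft ℝ ℝ Subtype.val ∘ₗ e.toLinearMap, fun x hx => ?_⟩
  rw [he, heA, Finset.mul_sum]
  refine Finset.sum_le_sum fun i _ => ?_
  by_cases hi : t < hA.eigenvalues i
  · have : e x i = 0 := congrFun hx ⟨i, hi⟩
    simp [this]
  · gcongr
    exact not_lt.1 hi

theorem card_lt_eigenvalues_le_add_finrank {V : Type*} [AddCommGroup V] [Module ℝ V]
    [FiniteDimensional ℝ V] (hA : A.IsHermitian) (hB : B.IsHermitian) (f : (ι → ℝ) →ₗ[ℝ] V)
    (h : ∀ x, f x = 0 → x ⬝ᵥ (A *ᵥ x) ≤ x ⬝ᵥ (B *ᵥ x)) (t : ℝ) :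
    Fintype.card {i // t < hA.eigenvalues i} ≤
      Fintype.card {i // t < hB.eigenvalues i} + Module.finrank ℝ V := by
  obtain ⟨g, hg⟩ := exists_linearMap_lt_dotProduct_mulVec hA t
  obtain ⟨q, hq⟩ := exists_linearMap_dotProduct_mulVec_le hB t
  by_contra! hlt
  have hker : ((q.prod f) ∘ₗ g).ker ≠ ⊥ := LinearMap.ker_ne_bot_of_finrank_lt (by simpa using hlt)
  obtain ⟨z, hz, hz0⟩ := Submodule.exists_mem_ne_zero_of_ne_bot hker
  obtain ⟨hqz, hfz⟩ : q (g z) = 0 ∧ f (g z) = 0 := by simpa using hz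
  exact ((hg z hz0).trans_le ((h _ hfz).trans (hq _ hqz))).false

theorem eigenvalues_mono (hA : A.IsHermitian) (hB : B.IsHermitian)
    (h : ∀ x, x ⬝ᵥ (A *ᵥ x) ≤ x ⬝ᵥ (B *ᵥ x)) : hA.eigenvalues ≤ hB.eigenvalues := by
  intro i
  by_contra! hlt
  have hcount := card_lt_eigenvalues_le_add_finrank hA hB (0 : _ →ₗ[ℝ] PUnit) (fun x _ => h x)
    (hB.eigenvalues i)
  rw [Module.finrank_zero_of_subsingleton, add_zero, Fintype.card_subtype, Fintype.card_subtype]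
    at hcount
  refine hcount.not_gt (Finset.card_lt_card ((Finset.ssubset_iff_of_subset fun j hj => ?_).2
    ⟨i, by simpa using hlt, by simp⟩))
  simp only [Finset.mem_filter_univ] at hj ⊢
  -- Both families of eigenvalues are sorted along the same enumeration of `ι`.
  let e := (Fintype.equivOfCardEq (Fintype.card_fin (Fintype.card ι))).symm
  have hij : e j ≤ e i := (hB.eigenvalues₀_antitone.reflect_lt hj).le
  exact hlt.trans_le (hA.eigenvalues₀_antitone hij)

end QuadraticForm

section RankOneUpdate

variable {ι : Type*} [Fintype ι] [DecidableEq ι]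

theorem eval_charpoly_add_vecMulVec {K : Type*} [Field K] (A : Matrix ι ι K) (u w : ι → K) {t : K}
    (ht : A.charpoly.eval t ≠ 0) :
    (A + vecMulVec u w).charpoly.eval t =
      A.charpoly.eval t * (1 - w ⬝ᵥ ((scalar ι t - A)⁻¹ *ᵥ u)) := by
  rw [eval_charpoly] at ht
  have hdet := det_add_replicateCol_mul_replicateRow (ι := Unit) (A := scalar ι t - A)
    (isUnit_iff_ne_zero.2 ht) (-u) w
  rw [← vecMulVec_eq, neg_vecMulVec, ← sub_eq_add_neg, sub_sub, ← eval_charpoly,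
    ← eval_charpoly, Matrix.mul_assoc, ← replicateCol_mulVec] at hdet
  rw [hdet, det_unique (n := Unit), Matrix.add_apply, one_apply_eq,
    replicateRow_mul_replicateCol_apply, mulVec_neg, dotProduct_neg, ← sub_eq_add_neg]

theorem eval_derivative_charpoly {K : Type*} [Field K] [Infinite K] (A : Matrix ι ι K) {t : K}
    (ht : A.charpoly.eval t ≠ 0) :
    (derivative A.charpoly).eval t = A.charpoly.eval t * (scalar ι t - A)⁻¹.trace := by
  rw [eval_charpoly] at ht ⊢
  set M := scalar ι t - A with hM
  have eval_det (s : K) : (det (1 + (X : K[X]) • M⁻¹.map C)).eval s = det (1 + s • M⁻¹) := by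
    rw [← coe_evalRingHom, RingHom.map_det]
    congr 1
    ext i j
    by_cases hij : i = j <;> simp [hij, mul_comm s]
  have factor (s : K) : scalar ι (s + t) - A = M * (1 + s • M⁻¹) := by
    rw [mul_add, mul_one, Matrix.mul_smul, mul_nonsing_inv _ (isUnit_iff_ne_zero.2 ht), hM,
      map_add, smul_one_eq_diagonal, scalar_apply, scalar_apply]
    abel
  have hcomp : A.charpoly.comp (X + C t) = C M.det * det (1 + (X : K[X]) • M⁻¹.map C) :=
    Polynomial.funext fun s => by
      rw [eval_mul, eval_det, eval_C, ← det_mul, ← factor, eval_comp, eval_charpoly]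
      simp
  have hderiv := congrArg (fun p => (derivative p).eval 0) hcomp
  simpa [derivative_comp, derivative_det_one_add_X_smul] using hderiv

theorem eq_of_eval_eq_of_eval_ne_zero {R : Type*} [CommRing R] [IsDomain R] [Infinite R]
    {p q d : R[X]} (hd : d ≠ 0) (h : ∀ t, d.eval t ≠ 0 → p.eval t = q.eval t) : p = q := by
  refine mul_left_cancel₀ hd (Polynomial.funext fun t => ?_)
  by_cases ht : d.eval t = 0
  · simp [ht]
  · simp [h t ht]

theorem sum_charpoly_add_vecMulVec {K α : Type*} [Field K] [Infinite K] [Fintype α]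
    (A : Matrix ι ι K) (p : α → K) (u w : α → ι → K) (hp : ∑ c, p c = 1)
    (huw : ∑ c, p c • vecMulVec (u c) (w c) = 1) :
    ∑ c, C (p c) * (A + vecMulVec (u c) (w c)).charpoly = A.charpoly - derivative A.charpoly := by
  refine eq_of_eval_eq_of_eval_ne_zero A.charpoly_monic.ne_zero fun t ht => ?_
  set M := (scalar ι t - A)⁻¹ with hM
  have htrace : ∑ c, p c * (w c ⬝ᵥ (M *ᵥ u c)) = M.trace := by
    calc _ = (M * ∑ c, p c • vecMulVec (u c) (w c)).trace := by
          simp only [Finset.mul_sum, trace_sum, Matrix.mul_smul, trace_smul, mul_vecMulVec,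
            trace_vecMulVec, smul_eq_mul, dotProduct_comm]
      _ = M.trace := by rw [huw, mul_one]
  simp only [eval_finsetSum, eval_mul, eval_C, eval_charpoly_add_vecMulVec A _ _ ht, eval_sub,
    eval_derivative_charpoly A ht, ← hM, ← htrace]
  calc ∑ c, p c * (A.charpoly.eval t * (1 - w c ⬝ᵥ (M *ᵥ u c)))
      = A.charpoly.eval t * (∑ c, p c - ∑ c, p c * (w c ⬝ᵥ (M *ᵥ u c))) := by
        rw [← Finset.sum_sub_distrib, Finset.mul_sum]
        exact Finset.sum_congr rfl fun c _ => by ring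
    _ = _ := by rw [hp, mul_sub, mul_one]

theorem charpoly_diagonal_add_vecMulVec {K : Type*} [Field K] [Infinite K] (d : ι → K) (μ : K) :
    (diagonal d + vecMulVec (μ • 1) 1).charpoly =
      (diagonal d).charpoly - C μ * derivative (diagonal d).charpoly := by
  refine eq_of_eval_eq_of_eval_ne_zero (diagonal d).charpoly_monic.ne_zero fun t ht => ?_
  have hinv : (scalar ι t - diagonal d)⁻¹ = diagonal (Ring.inverse fun i => t - d i) := by
    rw [scalar_apply, diagonal_sub, inv_diagonal]
  rw [eval_charpoly_add_vecMulVec _ _ _ ht, eval_sub, eval_mul, eval_C,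
    eval_derivative_charpoly _ ht, hinv, mulVec_smul, dotProduct_smul, trace_diagonal,
    one_dotProduct]
  simp only [mulVec_diagonal, Pi.one_apply, mul_one, smul_eq_mul]
  ring

end RankOneUpdate

section RootTuples

theorem isHermitian_diagonal_add_vecMulVec {ι : Type*} [DecidableEq ι] (lam : ι → ℝ) (μ : ℝ) :
    (diagonal lam + vecMulVec (μ • 1) 1).IsHermitian := by
  refine (isHermitian_diagonal lam).add (IsHermitian.ext fun i j => ?_)
  simp [vecMulVec_apply]

variable {ι : Type*} [Fintype ι]

/-- The monic real-rooted polynomial with roots `lam i`, listed with multiplicity. -/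
noncomputable def rootsPoly (lam : ι → ℝ) : ℝ[X] := ∏ i, (X - C (lam i))

theorem eval_rootsPoly (lam : ι → ℝ) (t : ℝ) : (rootsPoly lam).eval t = ∏ i, (t - lam i) := by
  simp [rootsPoly, eval_prod]

theorem charpoly_eq_rootsPoly [DecidableEq ι] {A : Matrix ι ι ℝ} (hA : A.IsHermitian) :
    A.charpoly = rootsPoly hA.eigenvalues :=
  hA.charpoly_eq

open Classical in
/-- The roots of `p - μ p'`, where `p` is the polynomial with roots `lam`. They are real because
they are the eigenvalues of the symmetric matrix `diag(lam) + μ 1 1ᵀ`. -/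
noncomputable def shiftRoots (μ : ℝ) (lam : ι → ℝ) : ι → ℝ :=
  (isHermitian_diagonal_add_vecMulVec lam μ).eigenvalues

theorem rootsPoly_shiftRoots (μ : ℝ) (lam : ι → ℝ) :
    rootsPoly (shiftRoots μ lam) = rootsPoly lam - C μ * derivative (rootsPoly lam) := by
  classical
  have hcharpoly := charpoly_diagonal_add_vecMulVec lam μ
  rw [charpoly_diagonal] at hcharpoly
  refine Eq.trans ?_ hcharpoly
  rw [charpoly_eq_rootsPoly (isHermitian_diagonal_add_vecMulVec lam μ), shiftRoots]

end RootTuples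

section LowerBarrier

variable {ι : Type*} [Fintype ι] {lam : ι → ℝ} {μ ν φ y z : ℝ}

/-- The lower barrier function `Φ_p(z) = -p'(z) / p(z)` of the polynomial `p` with roots `lam`,
measuring how far `z` stays below them. -/
noncomputable def lowerBarrier (lam : ι → ℝ) (z : ℝ) : ℝ := ∑ i, (lam i - z)⁻¹

theorem lowerBarrier_nonneg (hz : ∀ i, z < lam i) : 0 ≤ lowerBarrier lam z :=
  Finset.sum_nonneg fun i _ => (inv_pos.2 (sub_pos.2 (hz i))).le

theorem inv_le_sub_of_lowerBarrier_le (hz : ∀ i, z < lam i)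
    (hle : lowerBarrier lam z ≤ φ) (i : ι) : φ⁻¹ ≤ lam i - z := by
  have hi : (lam i - z)⁻¹ ≤ lowerBarrier lam z :=
    Finset.single_le_sum (f := fun i => (lam i - z)⁻¹)
      (fun j _ => (inv_pos.2 (sub_pos.2 (hz j))).le) (Finset.mem_univ i)
  exact inv_le_of_inv_le₀ (sub_pos.2 (hz i)) (hi.trans hle)

theorem eval_rootsPoly_ne_zero (hz : ∀ i, lam i ≠ z) : (rootsPoly lam).eval z ≠ 0 := by
  rw [eval_rootsPoly, Finset.prod_ne_zero_iff]
  exact fun i _ => sub_ne_zero.2 (hz i).symm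

theorem logDeriv_rootsPoly (hz : ∀ i, lam i ≠ z) :
    logDeriv (fun s => (rootsPoly lam).eval s) z = -lowerBarrier lam z := by
  simp only [eval_rootsPoly]
  rw [logDeriv_prod (fun i _ => sub_ne_zero.2 (hz i).symm) (fun i _ => by fun_prop),
    lowerBarrier, ← Finset.sum_neg_distrib]
  refine Finset.sum_congr rfl fun i _ => ?_
  rw [logDeriv_apply, deriv_sub_const, deriv_id'', one_div, ← neg_sub, inv_neg]

theorem eval_rootsPoly_shiftRoots (μ : ℝ) (hz : ∀ i, lam i ≠ z) :
    (rootsPoly (shiftRoots μ lam)).eval z =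
      (rootsPoly lam).eval z * (1 + μ * lowerBarrier lam z) := by
  have h0 := eval_rootsPoly_ne_zero hz
  have hlog := logDeriv_rootsPoly hz
  rw [logDeriv_apply, Polynomial.deriv, div_eq_iff h0] at hlog
  rw [rootsPoly_shiftRoots, eval_sub, eval_mul, eval_C, hlog]
  ring

theorem lt_shiftRoots (hμ : 0 ≤ μ) (hz : ∀ i, z < lam i) (i : ι) : z < shiftRoots μ lam i := by
  by_contra! hle
  have hlt (j : ι) : shiftRoots μ lam i < lam j := hle.trans_lt (hz j)
  have hroot : (rootsPoly (shiftRoots μ lam)).eval (shiftRoots μ lam i) = 0 := by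
    rw [eval_rootsPoly]
    exact Finset.prod_eq_zero (Finset.mem_univ i) (sub_self _)
  rw [eval_rootsPoly_shiftRoots μ fun j => (hlt j).ne'] at hroot
  have := lowerBarrier_nonneg hlt
  exact mul_ne_zero (eval_rootsPoly_ne_zero fun j => (hlt j).ne') (by positivity) hroot

theorem hasDerivAt_lowerBarrier (hz : ∀ i, lam i ≠ z) :
    HasDerivAt (lowerBarrier lam) (∑ i, (lam i - z)⁻¹ ^ 2) z := by
  refine HasDerivAt.fun_sum fun i _ => ?_
  refine (((hasDerivAt_id z).const_sub (lam i)).fun_inv (sub_ne_zero.2 (hz i))).congr_deriv ?_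
  simp

theorem lowerBarrier_shiftRoots_inv (hν : 0 < ν) (hz : ∀ i, z < lam i) :
    lowerBarrier (shiftRoots ν⁻¹ lam) z =
      lowerBarrier lam z - (∑ i, (lam i - z)⁻¹ ^ 2) / (ν + lowerBarrier lam z) := by
  have hne (i : ι) : lam i ≠ z := (hz i).ne'
  have hΦ := lowerBarrier_nonneg hz
  have hfactor : (fun s => (rootsPoly (shiftRoots ν⁻¹ lam)).eval s) =ᶠ[nhds z]
      fun s => (rootsPoly lam).eval s * (1 + ν⁻¹ * lowerBarrier lam s) := by
    have : ∀ᶠ s in nhds z, ∀ i, lam i ≠ s :=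
      Filter.eventually_all.2 fun i => (eventually_ne_nhds (hne i).symm).mono fun s hs => hs.symm
    exact this.mono fun s hs => eval_rootsPoly_shiftRoots _ hs
  have hderiv : HasDerivAt (fun s => 1 + ν⁻¹ * lowerBarrier lam s)
      (ν⁻¹ * ∑ i, (lam i - z)⁻¹ ^ 2) z := ((hasDerivAt_lowerBarrier hne).const_mul _).const_add 1
  have hlog := logDeriv_rootsPoly fun i => (lt_shiftRoots (inv_pos.2 hν).le hz i).ne'
  rw [(logDeriv_congr_nhds hfactor).eq_of_nhds,
    logDeriv_mul z (eval_rootsPoly_ne_zero hne) (by positivity) (by fun_prop)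
      hderiv.differentiableAt,
    logDeriv_rootsPoly hne, logDeriv_apply, hderiv.deriv] at hlog
  rw [← neg_eq_iff_eq_neg.2 hlog]
  field_simp
  ring

theorem add_inv_lt_of_lowerBarrier_le (hν : 0 < ν) (hφ : 0 < φ) (hy : ∀ i, y < lam i)
    (hle : lowerBarrier lam y ≤ φ) (i : ι) : y + (ν + φ)⁻¹ < lam i := by
  have h1 := inv_le_sub_of_lowerBarrier_le hy hle i
  have h2 : (ν + φ)⁻¹ < φ⁻¹ := inv_strictAnti₀ hφ (by linarith)
  linarith

theorem lowerBarrier_eq_add_mul_sum (hy : ∀ i, lam i ≠ y) (hz : ∀ i, lam i ≠ z) :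
    lowerBarrier lam z =
      lowerBarrier lam y + (z - y) * ∑ i, (lam i - y)⁻¹ * (lam i - z)⁻¹ := by
  rw [lowerBarrier, lowerBarrier, Finset.mul_sum, ← Finset.sum_add_distrib]
  refine Finset.sum_congr rfl fun i _ => ?_
  have := sub_ne_zero.2 (hy i)
  have := sub_ne_zero.2 (hz i)
  field_simp
  ring

theorem mul_sum_mul_add_lowerBarrier_le (hν : 0 ≤ ν) (hyz : y < z) (hz : ∀ i, z < lam i)
    (hle : (z - y) * (ν + lowerBarrier lam y) ≤ 1) :
    (z - y) * (∑ i, (lam i - y)⁻¹ * (lam i - z)⁻¹) * (ν + lowerBarrier lam z) ≤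
      ∑ i, (lam i - z)⁻¹ ^ 2 := by
  have hy (i : ι) : y < lam i := hyz.trans (hz i)
  have ha (i : ι) : 0 < (lam i - y)⁻¹ := inv_pos.2 (sub_pos.2 (hy i))
  have hb (i : ι) : 0 < (lam i - z)⁻¹ := inv_pos.2 (sub_pos.2 (hz i))
  set P := ∑ i, (lam i - y)⁻¹ * (lam i - z)⁻¹
  set R := ∑ i, (lam i - y)⁻¹ * (lam i - z)⁻¹ ^ 2 with hR
  have hP : 0 ≤ P := Finset.sum_nonneg fun i _ => (mul_pos (ha i) (hb i)).le
  have hR0 : 0 ≤ R := Finset.sum_nonneg fun i _ => (mul_pos (ha i) (pow_pos (hb i) 2)).le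
  have hQ : ∑ i, (lam i - z)⁻¹ ^ 2 = P + (z - y) * R := by
    rw [hR, Finset.mul_sum, ← Finset.sum_add_distrib]
    refine Finset.sum_congr rfl fun i _ => ?_
    have := (sub_pos.2 (hy i)).ne'
    have := (sub_pos.2 (hz i)).ne'
    field_simp
    ring
  have cauchy_schwarz : P ^ 2 ≤ lowerBarrier lam y * R :=
    Finset.sum_sq_le_sum_mul_sum_of_sq_le_mul _ (fun i _ => (ha i).le)
      (fun i _ => (mul_pos (ha i) (pow_pos (hb i) 2)).le) fun i _ => le_of_eq (by ring)
  have : 0 < z - y := sub_pos.2 hyz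
  have hδP : (z - y) * P ^ 2 ≤ R :=
    calc (z - y) * P ^ 2 ≤ (z - y) * lowerBarrier lam y * R := by
          rw [mul_assoc]; gcongr
      _ ≤ 1 * R := by gcongr; nlinarith
      _ = R := one_mul R
  rw [lowerBarrier_eq_add_mul_sum (fun i => (hy i).ne') fun i => (hz i).ne', hQ]
  calc (z - y) * P * (ν + (lowerBarrier lam y + (z - y) * P))
      = (z - y) * (ν + lowerBarrier lam y) * P + (z - y) * ((z - y) * P ^ 2) := by ring
    _ ≤ 1 * P + (z - y) * R := by gcongr
    _ = P + (z - y) * R := by rw [one_mul]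

theorem lowerBarrier_shiftRoots_inv_le (hν : 0 < ν) (hφ : 0 < φ) (hy : ∀ i, y < lam i)
    (hle : lowerBarrier lam y ≤ φ) :
    lowerBarrier (shiftRoots ν⁻¹ lam) (y + (ν + φ)⁻¹) ≤ φ := by
  have hz := add_inv_lt_of_lowerBarrier_le hν hφ hy hle
  set z := y + (ν + φ)⁻¹ with hz_def
  have hyz : y < z := by simp only [hz_def, lt_add_iff_pos_right]; positivity
  have hstep : (z - y) * (ν + lowerBarrier lam y) ≤ 1 := by
    rw [hz_def, add_sub_cancel_left, inv_mul_le_one₀ (by positivity)]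
    gcongr
  have hpos : 0 < ν + lowerBarrier lam z := add_pos_of_pos_of_nonneg hν (lowerBarrier_nonneg hz)
  have hdrop := (le_div_iff₀ hpos).2 (mul_sum_mul_add_lowerBarrier_le hν.le hyz hz hstep)
  rw [lowerBarrier_shiftRoots_inv hν hz]
  have hgrow := lowerBarrier_eq_add_mul_sum (fun i => (hy i).ne') fun i => (hz i).ne'
  linarith

theorem exists_rootsPoly_aeval_neg_derivative {κ : Type*} (ν : κ → ℝ) (s : Finset κ)
    (hν : ∀ c ∈ s, 0 < ν c) (hφ : 0 < φ) (hy : ∀ i, y < lam i) (hle : lowerBarrier lam y ≤ φ) :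
    ∃ lam' : ι → ℝ,
      aeval (-derivative : Module.End ℝ ℝ[X]) (∏ c ∈ s, (X + C (ν c))) (rootsPoly lam) =
        C (∏ c ∈ s, ν c) * rootsPoly lam' ∧
      (∀ i, y + ∑ c ∈ s, (ν c + φ)⁻¹ < lam' i) ∧
      lowerBarrier lam' (y + ∑ c ∈ s, (ν c + φ)⁻¹) ≤ φ := by
  classical
  induction s using Finset.induction_on with
  | empty => exact ⟨lam, by simp, by simpa using hy, by simpa using hle⟩
  | insert a s ha ih =>
    rw [Finset.forall_mem_insert] at hν
    obtain ⟨lam', hpoly, hlt, hbar⟩ := ih hν.2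
    refine ⟨shiftRoots (ν a)⁻¹ lam', ?_, ?_⟩
    · have hcancel : C (ν a) * C (ν a)⁻¹ = 1 := by rw [← C_mul, mul_inv_cancel₀ hν.1.ne', C_1]
      rw [Finset.prod_insert ha, map_mul, Module.End.mul_apply, hpoly, Finset.prod_insert ha, C_mul,
        rootsPoly_shiftRoots]
      generalize ∏ c ∈ s, ν c = b
      simp only [map_add, aeval_X, aeval_C, LinearMap.add_apply, LinearMap.neg_apply,
        derivative_C_mul, Module.algebraMap_end_apply, smul_eq_C_mul]
      linear_combination C b * derivative (rootsPoly lam') * hcancel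
    · rw [Finset.sum_insert ha, add_comm (ν a + φ)⁻¹, ← add_assoc]
      have hz := add_inv_lt_of_lowerBarrier_le hν.1 hφ hlt hbar
      exact ⟨lt_shiftRoots (inv_pos.2 hν.1).le hz, lowerBarrier_shiftRoots_inv_le hν.1 hφ hlt hbar⟩

end LowerBarrier

section Duality

theorem neg_derivative_pow_X_pow {R : Type*} [CommRing R] (m n : ℕ) :
    ((-derivative : Module.End R R[X]) ^ m) (X ^ n) =
      ((-1) ^ m * (n.descFactorial m : R)) • X ^ (n - m) := by
  rw [← neg_one_smul R, _root_.smul_pow, LinearMap.smul_apply, Module.End.pow_apply,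
    iterate_derivative_X_pow_eq_smul, smul_smul]

theorem eval_one_sub_derivative_pow_X_pow {R : Type*} [CommRing R] (j n : ℕ) :
    (((1 - derivative : Module.End R R[X]) ^ j) (X ^ n)).eval 0 =
      (-1) ^ n * (j.descFactorial n : R) := by
  have eval_term (m : ℕ) : (((-derivative : Module.End R R[X]) ^ m) (X ^ n)).eval 0 =
      if n = m then (-1) ^ n * (n.factorial : R) else 0 := by
    rw [neg_derivative_pow_X_pow, eval_smul, eval_pow, eval_X]
    rcases lt_trichotomy n m with h | rfl | h
    · simp [Nat.descFactorial_of_lt h, h.ne]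
    · simp [Nat.descFactorial_self]
    · simp [h.ne', (Nat.sub_pos_of_lt h).ne']
  rw [sub_eq_neg_add, (Commute.one_right _).add_pow, LinearMap.sum_apply, eval_finsetSum]
  simp only [one_pow, mul_one, ← nsmul_eq_mul', LinearMap.smul_apply, eval_smul, eval_term]
  simp only [smul_ite, smul_zero, Finset.sum_ite_eq]
  split_ifs with h
  · rw [smul_smul, mul_comm, Nat.descFactorial_eq_factorial_mul_choose]
  · rw [Nat.descFactorial_of_lt (by simpa using h), zero_smul]

theorem eval_one_sub_derivative_pow {R : Type*} [CommRing R] (j : ℕ) (h : R[X]) :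
    (((1 - derivative : Module.End R R[X]) ^ j) h).eval 0 =
      (aeval (-derivative : Module.End R R[X]) h (X ^ j)).eval 1 := by
  induction h using Polynomial.induction_on' with
  | add p q hp hq => simp only [map_add, LinearMap.add_apply, eval_add, hp, hq]
  | monomial n a =>
    rw [← C_mul_X_pow_eq_monomial, ← smul_eq_C_mul, map_smul, map_smul, LinearMap.smul_apply,
      eval_smul, eval_smul, aeval_X_pow, eval_one_sub_derivative_pow_X_pow,
      neg_derivative_pow_X_pow]
    simp

end Duality

section BarrierHeight

theorem exists_one_lt_sq_div_sub_sq_div {a c s : ℝ} (hc : 0 ≤ c) (hca : c < a) (hs : 0 < s)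
    (hsac : s < (a - c) ^ 2) : ∃ φ > 0, 1 < a ^ 2 / (s + φ) - c ^ 2 / φ := by
  have hsqrt : √s < a - c := (Real.sqrt_lt' (sub_pos.2 hca)).2 hsac
  obtain ⟨b, hcb, hb⟩ := exists_between (show c < a - √s by linarith)
  have hs' : √s < a - b := by linarith
  have hb0 : 0 < b := hc.trans_lt hcb
  have hab : 0 < a - b := (Real.sqrt_nonneg s).trans_lt hs'
  have : 0 < a := by linarith
  -- The optimal height when `c` is replaced by the slightly larger, hence positive, `b`.
  refine ⟨s * b / (a - b), by positivity, ?_⟩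
  have hheight : s + s * b / (a - b) = s * a / (a - b) := by field_simp; ring
  calc 1 < (a - b) ^ 2 / s := by rwa [one_lt_div hs, ← Real.sqrt_lt' hab]
    _ = a ^ 2 / (s + s * b / (a - b)) - b ^ 2 / (s * b / (a - b)) := by
        rw [hheight]
        field_simp
    _ ≤ a ^ 2 / (s + s * b / (a - b)) - c ^ 2 / (s * b / (a - b)) := by gcongr

variable {ι : Type*} [Fintype ι]

theorem card_sq_div_le_sum_inv_add {ν : ι → ℝ} {φ : ℝ} (hν : ∀ i, 0 < ν i + φ) :
    (Fintype.card ι : ℝ) ^ 2 / ∑ i, (ν i + φ) ≤ ∑ i, (ν i + φ)⁻¹ := by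
  have h := Finset.sq_sum_div_le_sum_sq_div Finset.univ (fun _ => (1 : ℝ)) fun i _ => hν i
  simp only [Finset.sum_const, Finset.card_univ, nsmul_eq_mul, mul_one, one_pow, one_div] at h
  exact h

variable {ν : ι → ℝ} {c : ℝ} {j : ℕ}

theorem exists_rootsPoly_aeval_neg_derivative_X_pow (hν : ∀ i, 0 < ν i) (hc : 0 ≤ c)
    (hcι : c < √(Fintype.card ι))
    (hsum : ∑ i, ν i < Fintype.card ι * (√(Fintype.card ι) - c) ^ 2) (hj : j ≤ c ^ 2 + 1) :
    ∃ lam : Fin j → ℝ,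
      aeval (-derivative : Module.End ℝ ℝ[X]) (∏ i, (X + C (ν i))) (X ^ j) =
        C (∏ i, ν i) * rootsPoly lam ∧ ∀ i, 1 < lam i := by
  set r := (Fintype.card ι : ℝ) with hr
  have hr0 : 0 < r := Real.sqrt_pos.1 (hc.trans_lt hcι)
  have : Nonempty ι := Fintype.card_pos_iff.1 (Nat.cast_pos.1 hr0)
  have hν0 : 0 < ∑ i, ν i := Finset.sum_pos (fun i _ => hν i) Finset.univ_nonempty
  obtain ⟨φ, hφ, hheight⟩ := exists_one_lt_sq_div_sub_sq_div hc hcι (div_pos hν0 hr0)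
    ((div_lt_iff₀' hr0).2 hsum)
  have hbarrier : lowerBarrier (0 : Fin j → ℝ) (-(j / φ)) ≤ φ := by
    have : (j : ℝ) * (φ / j) ≤ φ := by
      rw [mul_div_left_comm]
      exact mul_le_of_le_one_right hφ.le (div_self_le_one _)
    simpa [lowerBarrier] using this
  obtain ⟨lam, hpoly, hlt, hbar⟩ := exists_rootsPoly_aeval_neg_derivative ν Finset.univ
    (fun i _ => hν i) hφ (y := -(j / φ)) (lam := (0 : Fin j → ℝ))
    (fun i => neg_lt_zero.2 (div_pos (Nat.cast_pos.2 i.pos) hφ)) hbarrier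
  refine ⟨lam, by simpa [rootsPoly] using hpoly, fun i => ?_⟩
  have hmean : √r ^ 2 / ((∑ i, ν i) / r + φ) ≤ ∑ i, (ν i + φ)⁻¹ := by
    convert card_sq_div_le_sum_inv_add fun i => add_pos (hν i) hφ using 1
    rw [Finset.sum_add_distrib, Finset.sum_const, Finset.card_univ, nsmul_eq_mul, ← hr,
      Real.sq_sqrt hr0.le]
    field_simp
  have hgap := inv_le_sub_of_lowerBarrier_le hlt hbar i
  have hcφ : j / φ - φ⁻¹ ≤ c ^ 2 / φ := by
    rw [inv_eq_one_div, ← sub_div]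
    gcongr
    linarith
  linarith

theorem neg_one_pow_mul_eval_one_sub_derivative_pow_pos (hν : ∀ i, 0 < ν i) (hc : 0 ≤ c)
    (hcι : c < √(Fintype.card ι))
    (hsum : ∑ i, ν i < Fintype.card ι * (√(Fintype.card ι) - c) ^ 2) (hj : j ≤ c ^ 2 + 1) :
    0 < (-1) ^ j * (((1 - derivative : Module.End ℝ ℝ[X]) ^ j) (rootsPoly (-ν))).eval 0 := by
  obtain ⟨lam, hpoly, hlam⟩ := exists_rootsPoly_aeval_neg_derivative_X_pow hν hc hcι hsum hj
  have hprod : rootsPoly (-ν) = ∏ i, (X + C (ν i)) := by simp [rootsPoly]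
  have hsign : (-1) ^ j * ∏ i, (1 - lam i) = ∏ i, (lam i - 1) := by
    simpa using (Finset.prod_neg (s := Finset.univ) fun i => 1 - lam i).symm
  rw [eval_one_sub_derivative_pow, hprod, hpoly, eval_mul, eval_C, eval_rootsPoly, mul_left_comm,
    hsign]
  exact mul_pos (Finset.prod_pos fun i _ => hν i) (Finset.prod_pos fun i _ => sub_pos.2 (hlam i))

end BarrierHeight

section PosCount

variable {ι : Type*} [Fintype ι] {lam : ι → ℝ}

/-- The number of positive entries of a real vector. -/
noncomputable def posCount (lam : ι → ℝ) : ℕ := Fintype.card {i // 0 < lam i}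

theorem posCount_mono : Monotone (posCount : (ι → ℝ) → ℕ) := fun _ _ h =>
  Fintype.card_subtype_mono _ _ fun i hi => hi.trans_le (h i)

theorem posCount_eq_countP_roots (lam : ι → ℝ) :
    posCount lam = (rootsPoly lam).roots.countP (0 < ·) := by
  have hroots : (rootsPoly lam).roots = Finset.univ.val.map lam := by
    rw [rootsPoly, roots_prod _ _ (monic_prod_X_sub_C lam Finset.univ).ne_zero]
    simp
  rw [posCount, Fintype.card_subtype, hroots, Multiset.countP_map]
  rfl

theorem posCount_eigenvalues_diagonal [DecidableEq ι] (lam : ι → ℝ) :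
    posCount (isHermitian_diagonal lam).eigenvalues = posCount lam := by
  have hpoly : rootsPoly (isHermitian_diagonal lam).eigenvalues = rootsPoly lam :=
    (charpoly_eq_rootsPoly _).symm.trans (charpoly_diagonal lam)
  rw [posCount_eq_countP_roots, hpoly, ← posCount_eq_countP_roots]

theorem neg_one_pow_posCount_mul_eval_nonneg (lam : ι → ℝ) :
    0 ≤ (-1) ^ posCount lam * (rootsPoly lam).eval 0 := by
  have hpow : (-1 : ℝ) ^ posCount lam = ∏ i, if 0 < lam i then -1 else 1 := by
    rw [posCount, Fintype.card_subtype, ← Finset.prod_const, Finset.prod_filter]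
  rw [hpow, eval_rootsPoly, ← Finset.prod_mul_distrib]
  refine Finset.prod_nonneg fun i _ => ?_
  split_ifs <;> linarith

theorem posCount_eq_of_neg_one_pow_mul_eval_pos {k : ℕ} (hle : posCount lam ≤ k)
    (hge : k ≤ posCount lam + 1) (hsign : 0 < (-1) ^ k * (rootsPoly lam).eval 0) :
    posCount lam = k := by
  refine hle.antisymm (not_lt.1 fun hlt => ?_)
  obtain rfl : k = posCount lam + 1 := by omega
  have := neg_one_pow_posCount_mul_eval_nonneg lam
  rw [pow_succ] at hsign
  linarith

theorem dotProduct_vecMulVec_mulVec (u w x : ι → ℝ) :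
    x ⬝ᵥ (vecMulVec u w *ᵥ x) = (x ⬝ᵥ u) * (w ⬝ᵥ x) := by
  rw [vecMulVec_mulVec]
  simp [dotProduct_smul, mul_comm]

variable [DecidableEq ι] {A : Matrix ι ι ℝ}

theorem posCount_add_vecMulVec_le (hA : A.IsHermitian) {u w : ι → ℝ}
    (hB : (A + vecMulVec u w).IsHermitian) :
    posCount hB.eigenvalues ≤ posCount hA.eigenvalues + 1 := by
  refine (card_lt_eigenvalues_le_add_finrank hB hA (dotProductBilin ℝ ℝ w) (fun x hx => ?_)
    0).trans_eq (by rw [Module.finrank_self, posCount])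
  have hwx : w ⬝ᵥ x = 0 := hx
  rw [add_mulVec, dotProduct_add, dotProduct_vecMulVec_mulVec, hwx, mul_zero, add_zero]

theorem eigenvalues_le_add_vecMulVec (hA : A.IsHermitian) {u : ι → ℝ}
    (hB : (A + vecMulVec u u).IsHermitian) : hA.eigenvalues ≤ hB.eigenvalues :=
  eigenvalues_mono hA hB fun x => by
    rw [add_mulVec, dotProduct_add, dotProduct_vecMulVec_mulVec, dotProduct_comm x u]
    exact le_add_of_nonneg_right (mul_self_nonneg _)

end PosCount

section IterateShiftRoots

variable {ι : Type*} [Fintype ι]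

theorem shiftRoots_mono (μ : ℝ) : Monotone (shiftRoots μ : (ι → ℝ) → ι → ℝ) := by
  classical
  intro lam lam' h
  refine eigenvalues_mono _ _ fun x => ?_
  rw [add_mulVec, add_mulVec, dotProduct_add, dotProduct_add]
  gcongr
  refine Finset.sum_le_sum fun i _ => ?_
  rw [mulVec_diagonal, mulVec_diagonal, mul_left_comm, mul_left_comm (x i)]
  exact mul_le_mul_of_nonneg_right (h i) (mul_self_nonneg _)

theorem posCount_shiftRoots_le (μ : ℝ) (lam : ι → ℝ) :
    posCount (shiftRoots μ lam) ≤ posCount lam + 1 := by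
  classical
  exact (posCount_add_vecMulVec_le (isHermitian_diagonal lam) _).trans_eq
    (by rw [posCount_eigenvalues_diagonal])

theorem posCount_iterate_shiftRoots_le (μ : ℝ) (lam : ι → ℝ) (l : ℕ) :
    posCount ((shiftRoots μ)^[l] lam) ≤ posCount lam + l := by
  induction l with
  | zero => rfl
  | succ l ih =>
    rw [Function.iterate_succ_apply']
    exact (posCount_shiftRoots_le μ _).trans (by omega)

theorem posCount_le_shiftRoots_one (lam : ι → ℝ) : posCount lam ≤ posCount (shiftRoots 1 lam) := by
  classical
  rw [← posCount_eigenvalues_diagonal lam]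
  refine posCount_mono (eigenvalues_mono _ _ fun x => ?_)
  rw [add_mulVec, dotProduct_add, dotProduct_vecMulVec_mulVec, one_smul,
    dotProduct_comm x 1]
  exact le_add_of_nonneg_right (mul_self_nonneg _)

theorem rootsPoly_iterate_shiftRoots_one (lam : ι → ℝ) (l : ℕ) :
    rootsPoly ((shiftRoots 1)^[l] lam) =
      ((1 - derivative : Module.End ℝ ℝ[X]) ^ l) (rootsPoly lam) := by
  induction l with
  | zero => rfl
  | succ l ih =>
    rw [Function.iterate_succ_apply', rootsPoly_shiftRoots, ih, pow_succ', Module.End.mul_apply]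
    simp

end IterateShiftRoots

section Greedy

variable {ι α : Type*} [Fintype ι]

theorem posCount_iterate_shiftRoots_one_eq {lam : ι → ℝ} (hlam : posCount lam = 0) {k : ℕ}
    (hsign : ∀ j ≤ k,
      0 < (-1) ^ j * (((1 - derivative : Module.End ℝ ℝ[X]) ^ j) (rootsPoly lam)).eval 0) :
    posCount ((shiftRoots 1)^[k] lam) = k := by
  induction k with
  | zero => exact hlam
  | succ k ih =>
    have hk := ih fun j hj => hsign j (hj.trans k.le_succ)
    have hpos := hsign (k + 1) le_rfl
    rw [← rootsPoly_iterate_shiftRoots_one] at hpos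
    rw [Function.iterate_succ_apply'] at hpos ⊢
    have hle := posCount_shiftRoots_le 1 ((shiftRoots 1)^[k] lam)
    have hge := posCount_le_shiftRoots_one ((shiftRoots 1)^[k] lam)
    exact posCount_eq_of_neg_one_pow_mul_eval_pos (by omega) (by omega) hpos

variable [DecidableEq ι] [Fintype α] {p : α → ℝ} {u w : α → ι → ℝ} {A : Matrix ι ι ℝ}

theorem exists_pos_charpoly_add_vecMulVec (hp : ∀ c, 0 ≤ p c) (hp1 : ∑ c, p c = 1)
    (huw : ∑ c, p c • vecMulVec (u c) (w c) = 1) (L : ℝ[X] →ₗ[ℝ] ℝ)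
    (hL : 0 < L (A.charpoly - derivative A.charpoly)) :
    ∃ c, 0 < L (A + vecMulVec (u c) (w c)).charpoly := by
  by_contra! h
  rw [← sum_charpoly_add_vecMulVec A p u w hp1 huw, map_sum] at hL
  refine hL.not_ge (Finset.sum_nonpos fun c _ => ?_)
  rw [← smul_eq_C_mul, map_smul]
  exact mul_nonpos_of_nonneg_of_nonpos (hp c) (h c)

theorem exists_posCount_add_sum_vecMulVec_eq (hp : ∀ c, 0 ≤ p c) (hp1 : ∑ c, p c = 1)
    (hu : ∑ c, p c • vecMulVec (u c) (u c) = 1) (hA : A.IsHermitian) {k l : ℕ}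
    (hle : posCount hA.eigenvalues + l ≤ k)
    (hcount : posCount ((shiftRoots 1)^[l] hA.eigenvalues) = k)
    (hsign : 0 < (-1) ^ k * (((1 - derivative : Module.End ℝ ℝ[X]) ^ l) A.charpoly).eval 0) :
    ∃ (s : Fin l → α) (hB : (A + ∑ j, vecMulVec (u (s j)) (u (s j))).IsHermitian),
      posCount hB.eigenvalues = k := by
  induction l generalizing A with
  | zero =>
    refine ⟨Fin.elim0, ?_⟩
    rw [Fin.sum_univ_zero, add_zero]
    exact ⟨hA, hcount⟩
  | succ l ih =>
    let L : ℝ[X] →ₗ[ℝ] ℝ := (-1 : ℝ) ^ k • leval 0 ∘ₗ (1 - derivative : Module.End ℝ ℝ[X]) ^ l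
    rw [pow_succ, Module.End.mul_apply] at hsign
    obtain ⟨a, ha⟩ := exists_pos_charpoly_add_vecMulVec hp hp1 hu L hsign
    have hB : (A + vecMulVec (u a) (u a)).IsHermitian :=
      hA.add (IsHermitian.ext fun i j => by simp [vecMulVec_apply, mul_comm])
    have hBle := posCount_add_vecMulVec_le hA hB
    have hpos : 0 < (-1) ^ k * (rootsPoly ((shiftRoots 1)^[l] hB.eigenvalues)).eval 0 := by
      rw [rootsPoly_iterate_shiftRoots_one, ← charpoly_eq_rootsPoly]
      exact ha
    have hcountB : posCount ((shiftRoots 1)^[l] hB.eigenvalues) = k := by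
      have hupper := posCount_iterate_shiftRoots_le 1 hB.eigenvalues l
      have hmono := posCount_mono
        ((shiftRoots_mono 1).iterate l (eigenvalues_le_add_vecMulVec hA hB))
      have hlower := posCount_shiftRoots_le 1 ((shiftRoots 1)^[l] hA.eigenvalues)
      rw [← Function.iterate_succ_apply' (shiftRoots 1), hcount] at hlower
      exact posCount_eq_of_neg_one_pow_mul_eval_pos (by omega) (by omega) hpos
    obtain ⟨s, hs⟩ := ih hB (by omega) hcountB ha
    refine ⟨Fin.cons a s, ?_⟩
    rw [Fin.sum_univ_succ, ← add_assoc]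
    exact hs

theorem exists_posCount_diagonal_neg_add_sum_vecMulVec_eq (hp : ∀ c, 0 ≤ p c)
    (hp1 : ∑ c, p c = 1) (hu : ∑ c, p c • vecMulVec (u c) (u c) = 1) {ν : ι → ℝ}
    (hν : ∀ i, 0 < ν i) {c : ℝ} (hc : 0 ≤ c) (hcι : c < √(Fintype.card ι))
    (hsum : ∑ i, ν i < Fintype.card ι * (√(Fintype.card ι) - c) ^ 2) {k : ℕ}
    (hk : k ≤ c ^ 2 + 1) :
    ∃ (s : Fin k → α) (hB : (diagonal (-ν) + ∑ j, vecMulVec (u (s j)) (u (s j))).IsHermitian),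
      posCount hB.eigenvalues = k := by
  have hA : (diagonal (-ν)).IsHermitian := isHermitian_diagonal _
  have hzero : posCount hA.eigenvalues = 0 := by
    rw [posCount_eigenvalues_diagonal, posCount, Fintype.card_eq_zero_iff]
    exact ⟨fun i => (neg_pos.1 i.2).not_gt (hν i)⟩
  have hpoly : rootsPoly hA.eigenvalues = rootsPoly (-ν) :=
    (charpoly_eq_rootsPoly hA).symm.trans (charpoly_diagonal _)
  have hsign (j : ℕ) (hj : j ≤ k) := neg_one_pow_mul_eval_one_sub_derivative_pow_pos hν hc hcι hsum
    (j := j) (hk.trans' (Nat.cast_le.2 hj))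
  exact exists_posCount_add_sum_vecMulVec_eq hp hp1 hu hA (by omega)
    (posCount_iterate_shiftRoots_one_eq hzero (hpoly ▸ hsign))
    ((charpoly_diagonal (-ν)).symm ▸ hsign k le_rfl)

end Greedy

section ColumnSelection

variable {ι κ α : Type*} [Fintype ι] [Fintype κ] {u : α → ι → ℝ}

theorem injective_of_forall_sum_sq_le {s : κ → α} {a : ι → ℝ}
    (h : ∀ z : κ → ℝ, ∑ j, z j ^ 2 ≤ ∑ i, a i * (∑ j, z j * u (s j) i) ^ 2) :
    Function.Injective s := by
  classical
  intro j j' hjj'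
  by_contra hne
  have hz := h (Pi.single j 1 - Pi.single j' 1)
  have hcancel (i : ι) : ∑ l, (Pi.single j 1 - Pi.single j' 1 : κ → ℝ) l * u (s l) i = 0 := by
    simp [sub_mul, Finset.sum_sub_distrib, Pi.single_apply, hjj']
  simp only [hcancel, zero_pow two_ne_zero, mul_zero, Finset.sum_const_zero] at hz
  have hzero := (Finset.sum_eq_zero_iff_of_nonneg fun l _ => sq_nonneg _).1
    (hz.antisymm (Finset.sum_nonneg fun l _ => sq_nonneg _)) j (Finset.mem_univ j)
  simp [hne] at hzero

variable [DecidableEq ι] {ν : ι → ℝ} {v : κ → ι → ℝ}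

theorem dotProduct_diagonal_neg_add_sum_vecMulVec_mulVec (ν : ι → ℝ) (v : κ → ι → ℝ)
    (x : ι → ℝ) :
    x ⬝ᵥ ((diagonal (-ν) + ∑ j, vecMulVec (v j) (v j)) *ᵥ x) =
      ∑ j, (v j ⬝ᵥ x) ^ 2 - ∑ i, ν i * x i ^ 2 := by
  have hdiag : x ⬝ᵥ (diagonal (-ν) *ᵥ x) = -∑ i, ν i * x i ^ 2 := by
    rw [dotProduct, ← Finset.sum_neg_distrib]
    refine Finset.sum_congr rfl fun i _ => ?_
    rw [mulVec_diagonal, Pi.neg_apply]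
    ring
  have hrank : x ⬝ᵥ ((∑ j, vecMulVec (v j) (v j)) *ᵥ x) = ∑ j, (v j ⬝ᵥ x) ^ 2 := by
    rw [sum_mulVec, dotProduct_sum]
    refine Finset.sum_congr rfl fun j _ => ?_
    rw [dotProduct_vecMulVec_mulVec, dotProduct_comm x, sq]
  rw [add_mulVec, dotProduct_add, hdiag, hrank, neg_add_eq_sub]

theorem exists_dotProduct_eq_of_posCount_eq_card (hν : ∀ i, 0 ≤ ν i)
    (hB : (diagonal (-ν) + ∑ j, vecMulVec (v j) (v j)).IsHermitian)
    (hcount : posCount hB.eigenvalues = Fintype.card κ) (z : κ → ℝ) :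
    ∃ x : ι → ℝ, (∀ j, v j ⬝ᵥ x = z j) ∧ ∑ i, ν i * x i ^ 2 ≤ ∑ j, z j ^ 2 := by
  obtain ⟨g, hg⟩ := exists_linearMap_lt_dotProduct_mulVec hB 0
  simp only [dotProduct_diagonal_neg_add_sum_vecMulVec_mulVec, zero_mul, sub_pos] at hg
  have hinj : Function.Injective (mulVecLin (of v) ∘ₗ g) := by
    rw [← LinearMap.ker_eq_bot, LinearMap.ker_eq_bot']
    intro y hy
    by_contra hy0
    have hzero (j : κ) : v j ⬝ᵥ g y = 0 := congrFun hy j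
    have hneg := hg y hy0
    simp only [hzero, zero_pow two_ne_zero, Finset.sum_const_zero] at hneg
    exact hneg.not_ge (Finset.sum_nonneg fun i _ => mul_nonneg (hν i) (sq_nonneg _))
  obtain ⟨y, hy⟩ := (LinearMap.injective_iff_surjective_of_finrank_eq_finrank
    (by simpa [posCount] using hcount)).1 hinj z
  have hyz (j : κ) : v j ⬝ᵥ g y = z j := congrFun hy j
  refine ⟨g y, hyz, ?_⟩
  simp only [← hyz]
  rcases eq_or_ne y 0 with rfl | hy0
  · simp
  · exact (hg y hy0).le

theorem sum_sq_le_of_posCount_eq_card (hν : ∀ i, 0 < ν i)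
    (hB : (diagonal (-ν) + ∑ j, vecMulVec (v j) (v j)).IsHermitian)
    (hcount : posCount hB.eigenvalues = Fintype.card κ) (z : κ → ℝ) :
    ∑ j, z j ^ 2 ≤ ∑ i, (ν i)⁻¹ * (∑ j, z j * v j i) ^ 2 := by
  obtain ⟨x, hx, hxz⟩ := exists_dotProduct_eq_of_posCount_eq_card (fun i => (hν i).le) hB hcount z
  have hpair : ∑ j, z j ^ 2 = ∑ i, (∑ j, z j * v j i) * x i := by
    simp only [Finset.sum_mul]
    rw [Finset.sum_comm]
    refine Finset.sum_congr rfl fun j _ => ?_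
    rw [sq]
    nth_rw 2 [← hx j]
    simp only [dotProduct, Finset.mul_sum, mul_assoc]
  have hV (i : ι) : 0 ≤ (ν i)⁻¹ * (∑ j, z j * v j i) ^ 2 :=
    mul_nonneg (inv_pos.2 (hν i)).le (sq_nonneg _)
  have cauchy_schwarz : (∑ j, z j ^ 2) ^ 2 ≤
      (∑ i, (ν i)⁻¹ * (∑ j, z j * v j i) ^ 2) * ∑ i, ν i * x i ^ 2 := by
    rw [hpair]
    refine Finset.sum_sq_le_sum_mul_sum_of_sq_le_mul _ (fun i _ => hV i)
      (fun i _ => mul_nonneg (hν i).le (sq_nonneg _)) fun i _ => le_of_eq ?_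
    have := (hν i).ne'
    field_simp
  rcases (Finset.sum_nonneg fun j _ => sq_nonneg (z j)).eq_or_lt with h0 | hpos
  · rw [← h0]
    exact Finset.sum_nonneg fun i _ => hV i
  · refine le_of_mul_le_mul_right ?_ hpos
    rw [← sq]
    exact cauchy_schwarz.trans
      (mul_le_mul_of_nonneg_left hxz (Finset.sum_nonneg fun i _ => hV i))

variable [Fintype α] {p : α → ℝ} {c : ℝ} {k : ℕ}

theorem exists_finset_forall_sum_sq_le_of_sum_eq_one (hp : ∀ a, 0 ≤ p a) (hp1 : ∑ a, p a = 1)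
    (hu : ∑ a, p a • vecMulVec (u a) (u a) = 1) (hν : ∀ i, 0 < ν i) (hc : 0 ≤ c)
    (hcι : c < √(Fintype.card ι))
    (hsum : ∑ i, ν i < Fintype.card ι * (√(Fintype.card ι) - c) ^ 2) (hk : k ≤ c ^ 2 + 1) :
    ∃ S : Finset α, S.card = k ∧
      ∀ z : S → ℝ, ∑ a, z a ^ 2 ≤ ∑ i, (ν i)⁻¹ * (∑ a, z a * u a i) ^ 2 := by
  obtain ⟨s, hB, hcount⟩ :=
    exists_posCount_diagonal_neg_add_sum_vecMulVec_eq hp hp1 hu hν hc hcι hsum hk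
  have hs := sum_sq_le_of_posCount_eq_card hν hB (by rw [hcount, Fintype.card_fin])
  have hinj : Function.Injective s := injective_of_forall_sum_sq_le hs
  let S : Finset α := Finset.univ.map ⟨s, hinj⟩
  refine ⟨S, by simp [S], fun z => ?_⟩
  let e (j : Fin k) : S := ⟨s j, Finset.mem_map_of_mem ⟨s, hinj⟩ (Finset.mem_univ j)⟩
  have he : Function.Bijective e :=
    ⟨fun j j' h => hinj (congrArg Subtype.val h), fun ⟨a, ha⟩ => by
      obtain ⟨j, -, rfl⟩ := Finset.mem_map.1 ha
      exact ⟨j, rfl⟩⟩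
  simp only [← he.sum_comp]
  exact hs fun j => z (e j)

theorem exists_finset_forall_sum_sq_le (hp : ∀ a, 0 ≤ p a) (hp0 : 0 < ∑ a, p a)
    (hu : ∑ a, p a • vecMulVec (u a) (u a) = 1) (hν : ∀ i, 0 < ν i) (hc : 0 ≤ c)
    (hcι : c < √(Fintype.card ι))
    (hsum : ∑ i, ν i < Fintype.card ι * (√(Fintype.card ι) - c) ^ 2) (hk : k ≤ c ^ 2 + 1) :
    ∃ S : Finset α, S.card = k ∧
      ∀ z : S → ℝ, ∑ a, z a ^ 2 ≤ (∑ a, p a) * ∑ i, (ν i)⁻¹ * (∑ a, z a * u a i) ^ 2 := by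
  set Z := ∑ a, p a
  have hnormalized : ∑ a, (p a / Z) • vecMulVec (√Z • u a) (√Z • u a) = 1 := by
    rw [← hu]
    refine Finset.sum_congr rfl fun a _ => ?_
    rw [smul_vecMulVec, vecMulVec_smul, smul_smul, smul_smul, mul_assoc,
      Real.mul_self_sqrt hp0.le, div_mul_cancel₀ _ hp0.ne']
  obtain ⟨S, hS, hSz⟩ := exists_finset_forall_sum_sq_le_of_sum_eq_one (p := fun a => p a / Z)
    (u := fun a => √Z • u a) (fun a => div_nonneg (hp a) hp0.le)
    (by rw [← Finset.sum_div, div_self hp0.ne']) hnormalized hν hc hcι hsum hk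
  refine ⟨S, hS, fun z => (hSz z).trans_eq ?_⟩
  rw [Finset.mul_sum]
  refine Finset.sum_congr rfl fun i _ => ?_
  simp only [Pi.smul_apply, smul_eq_mul, mul_left_comm _ (√Z), ← Finset.mul_sum, mul_pow,
    Real.sq_sqrt hp0.le, mul_left_comm (ν i)⁻¹]

end ColumnSelection

section SingularVectors

variable {E F : Type*} [NormedAddCommGroup E] [InnerProductSpace ℝ E] [FiniteDimensional ℝ E]
  [NormedAddCommGroup F] [InnerProductSpace ℝ F] [FiniteDimensional ℝ F]

theorem exists_orthonormalBasis_norm_sq_eq (T : E →ₗ[ℝ] F) :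
    ∃ e : OrthonormalBasis (Fin (Module.finrank ℝ E)) ℝ E,
      ∀ x, ‖T x‖ ^ 2 =
        ∑ i : Fin (Module.finrank ℝ E), T.singularValues i ^ 2 * inner ℝ (e i) x ^ 2 := by
  refine ⟨T.isSymmetric_adjoint_comp_self.eigenvectorBasis rfl, fun x => ?_⟩
  set e := T.isSymmetric_adjoint_comp_self.eigenvectorBasis rfl with he
  rw [← real_inner_self_eq_norm_sq, ← LinearMap.adjoint_inner_right, ← LinearMap.comp_apply,
    ← e.sum_inner_mul_inner]
  refine Finset.sum_congr rfl fun i _ => ?_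
  rw [← T.isSymmetric_adjoint_comp_self, he,
    T.isSymmetric_adjoint_comp_self.apply_eigenvectorBasis, inner_smul_left,
    T.sq_singularValues_fin rfl, real_inner_comm x]
  simp only [Real.ringHom_apply]
  ring

theorem exists_orthonormal_sum_singularValues_sq_mul_inner_sq_le (T : E →ₗ[ℝ] F) {r : ℕ}
    (hr : r ≤ Module.finrank ℝ E) :
    ∃ e : Fin r → E, Orthonormal ℝ e ∧
      ∀ x, ∑ i : Fin r, T.singularValues i ^ 2 * inner ℝ (e i) x ^ 2 ≤ ‖T x‖ ^ 2 := by
  obtain ⟨e, he⟩ := exists_orthonormalBasis_norm_sq_eq T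
  refine ⟨e ∘ Fin.castLE hr, e.orthonormal.comp _ (Fin.castLE_injective hr), fun x => ?_⟩
  have hsub := Finset.sum_le_univ_sum_of_nonneg (s := Finset.univ.map (Fin.castLEEmb hr))
    fun i => mul_nonneg (sq_nonneg (T.singularValues i)) (sq_nonneg (inner ℝ (e i) x))
  rw [he]
  rwa [Finset.sum_map] at hsub

end SingularVectors

section DiagonalScaling

theorem sum_inv_sq_smul_vecMulVec_eq_one {ι m : Type*} [DecidableEq ι] [Fintype m]
    {e : ι → EuclideanSpace ℝ m} (he : Orthonormal ℝ e) {w : m → ℝ} (hw : ∀ a, w a ≠ 0) :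
    ∑ a, (w a ^ 2)⁻¹ • vecMulVec (fun i => w a * e i a) (fun i => w a * e i a) = 1 := by
  ext i j
  rw [Matrix.sum_apply, one_apply, ← orthonormal_iff_ite.1 he i j, PiLp.inner_apply]
  refine Finset.sum_congr rfl fun a _ => ?_
  have := hw a
  simp only [Matrix.smul_apply, vecMulVec_apply, smul_eq_mul, RCLike.inner_apply,
    Real.ringHom_apply]
  field_simp

variable {n m : ℕ} {W : Matrix (Fin m) (Fin m) ℝ}

theorem frobeniusNorm_inv_sq_of_isDiag (hW : W.IsDiag) (hW0 : ∀ i, W i i ≠ 0) :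
    frobeniusNorm W⁻¹ ^ 2 = ∑ i, (W i i ^ 2)⁻¹ := by
  have hinv : W⁻¹ = diagonal fun i => (W i i)⁻¹ := by
    refine inv_eq_right_inv ?_
    nth_rw 1 [← hW.diagonal_diag]
    rw [diagonal_mul_diagonal, ← diagonal_one]
    exact congrArg diagonal (funext fun i => mul_inv_cancel₀ (hW0 i))
  rw [hinv, frobeniusNorm, frobenius_norm_diagonal, EuclideanSpace.norm_sq_eq]
  simp

theorem columns_mul_principal (A : Matrix (Fin n) (Fin m) ℝ) (hW : W.IsDiag)
    (S : Finset (Fin m)) : columns A S * principal W S = A * columns W S := by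
  ext i a
  have hdiag (b : Fin m) (hb : b ∉ S) : A i b * W b a = 0 := by
    rw [hW fun hba : b = a => hb (hba ▸ a.2), mul_zero]
  simp only [mul_apply, columns, principal, submatrix_apply, id]
  rw [Finset.sum_coe_sort S fun b => A i b * W b a]
  exact Finset.sum_subset (Finset.subset_univ S) fun b _ hb => hdiag b hb

theorem inner_toEuclideanLin_columns (hW : W.IsDiag) (S : Finset (Fin m))
    (e : EuclideanSpace ℝ (Fin m)) (z : EuclideanSpace ℝ S) :
    inner ℝ e (toEuclideanLin (columns W S) z) = ∑ a, z a * (W a a * e a) := by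
  have hentry (b : Fin m) : toEuclideanLin (columns W S) z b = ∑ a : S, W b a * z a := by
    rw [toLpLin_apply]
    rfl
  simp only [PiLp.inner_apply, hentry, RCLike.inner_apply, conj_trivial, Finset.sum_mul]
  rw [Finset.sum_comm]
  refine Finset.sum_congr rfl fun a _ => ?_
  rw [Finset.sum_eq_single a.1 (fun b _ hba => by rw [hW hba, zero_mul, zero_mul]) (by simp)]
  ring

theorem singularValue_pos {A : Matrix (Fin n) (Fin m) ℝ} {i : ℕ} (hi : i < A.rank) :
    0 < singularValue A i := by
  rw [singularValue, LinearMap.singularValues_pos_iff_lt_finrank_range,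
    toEuclideanLin_eq_toLin_orthonormal]
  exact hi.trans_eq (rank_eq_finrank_range_toLin A _ _)

end DiagonalScaling

section SubsetSelection

variable {n m : ℕ} {W : Matrix (Fin m) (Fin m) ℝ} {k r : ℕ}

theorem frobeniusNorm_inv_sq_pos [NeZero m] (hW : W.IsDiag) (hW0 : ∀ i, W i i ≠ 0) :
    0 < frobeniusNorm W⁻¹ ^ 2 := by
  rw [frobeniusNorm_inv_sq_of_isDiag hW hW0]
  exact Finset.sum_pos (fun a _ => inv_pos.2 (sq_pos_of_ne_zero (hW0 a))) Finset.univ_nonempty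

theorem sum_inv_singularValue_sq_pos {A : Matrix (Fin n) (Fin m) ℝ} (hr0 : r ≠ 0)
    (hr : r ≤ A.rank) : 0 < ∑ i ∈ Finset.range r, (singularValue A i ^ 2)⁻¹ :=
  Finset.sum_pos (fun _ hi => inv_pos.2 <| sq_pos_of_pos <|
    singularValue_pos <| (Finset.mem_range.1 hi).trans_le hr) (Finset.nonempty_range_iff.2 hr0)

theorem exists_finset_forall_mul_norm_sq_le (A : Matrix (Fin n) (Fin m) ℝ) (hW : W.IsDiag)
    (hW0 : ∀ i, W i i ≠ 0) (hr : r ≤ A.rank) {c t : ℝ} (hc : 0 ≤ c) (hcr : c < √r)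
    (hk : k ≤ c ^ 2 + 1) (ht : 0 < t)
    (hlt : t < (√r - c) ^ 2 / frobeniusNorm W⁻¹ ^ 2 *
      (r / ∑ i ∈ Finset.range r, (singularValue A i ^ 2)⁻¹)) :
    ∃ S : Finset (Fin m), S.card = k ∧ ∀ z : EuclideanSpace ℝ S,
      t * ‖z‖ ^ 2 ≤ ‖toEuclideanLin (columns A S * principal W S) z‖ ^ 2 := by
  have hr0 : 0 < r := Nat.cast_pos.1 (Real.sqrt_pos.1 (hc.trans_lt hcr))
  have hrm : r ≤ m := hr.trans A.rank_le_width
  have : NeZero m := ⟨by omega⟩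
  have hσ (i : Fin r) : 0 < singularValue A i := singularValue_pos (i.2.trans_le hr)
  have hQ := sum_inv_singularValue_sq_pos hr0.ne' hr
  have hZ := frobeniusNorm_inv_sq_pos hW hW0
  have hZ_sum := frobeniusNorm_inv_sq_of_isDiag hW hW0
  set Z := frobeniusNorm W⁻¹ ^ 2
  obtain ⟨e, he, hnorm⟩ := exists_orthonormal_sum_singularValues_sq_mul_inner_sq_le
    (toEuclideanLin A) (hrm.trans_eq finrank_euclideanSpace_fin.symm)
  have hsum : ∑ i : Fin r, t * Z * (singularValue A i ^ 2)⁻¹ < r * (√r - c) ^ 2 := by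
    rw [div_mul_div_comm, lt_div_iff₀ (mul_pos hZ hQ)] at hlt
    rw [← Finset.mul_sum, Fin.sum_univ_eq_sum_range fun i => (singularValue A i ^ 2)⁻¹]
    linarith
  obtain ⟨S, hS, hSz⟩ := exists_finset_forall_sum_sq_le
    (ν := fun i : Fin r => t * Z * (singularValue A i ^ 2)⁻¹)
    (fun a => inv_nonneg.2 (sq_nonneg _)) (hZ_sum ▸ hZ) (sum_inv_sq_smul_vecMulVec_eq_one he hW0)
    (fun i => mul_pos (mul_pos ht hZ) (inv_pos.2 (sq_pos_of_pos (hσ i)))) hc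
    (by rwa [Fintype.card_fin]) (by rwa [Fintype.card_fin]) hk
  rw [← hZ_sum] at hSz
  refine ⟨S, hS, fun z => ?_⟩
  calc t * ‖z‖ ^ 2 = t * ∑ a, z a ^ 2 := by rw [EuclideanSpace.real_norm_sq_eq]
    _ ≤ t * (Z * ∑ i : Fin r, (t * Z * (singularValue A i ^ 2)⁻¹)⁻¹ *
          (∑ a, z a * (W a a * e i a)) ^ 2) := by
        gcongr
        exact hSz z
    _ = ∑ i : Fin r, singularValue A i ^ 2 * (∑ a, z a * (W a a * e i a)) ^ 2 := by
        rw [Finset.mul_sum, Finset.mul_sum]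
        refine Finset.sum_congr rfl fun i _ => ?_
        have := (hσ i).ne'
        field_simp
    _ ≤ ‖toEuclideanLin A (toEuclideanLin (columns W S) z)‖ ^ 2 := by
        simpa only [inner_toEuclideanLin_columns hW, singularValue] using
          hnorm (toEuclideanLin (columns W S) z)
    _ = _ := by rw [columns_mul_principal A hW, toLpLin_mul_same, LinearMap.comp_apply]

theorem le_sigmaMin_sq {ι κ : Type*} [Fintype ι] [Fintype κ] [DecidableEq κ] [Nonempty κ]
    {B : Matrix ι κ ℝ} {t : ℝ} (h : ∀ z, t * ‖z‖ ^ 2 ≤ ‖toEuclideanLin B z‖ ^ 2) :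
    t ≤ sigmaMin B ^ 2 := by
  have : Nonempty (Metric.sphere (0 : EuclideanSpace ℝ κ) 1) :=
    (NormedSpace.sphere_nonempty.2 zero_le_one).coe_sort
  refine (Real.sqrt_le_left (Real.iInf_nonneg fun x => norm_nonneg _)).1 ?_
  refine le_ciInf fun x => Real.sqrt_le_iff.2 ⟨norm_nonneg _, ?_⟩
  simpa using h x

theorem exists_le_of_forall_mem_Ioo {α β : Type*} [Finite α] [LinearOrder β] [DenselyOrdered β]
    {P : α → Prop} {f : α → β} {a b : β} (hab : a < b)
    (h : ∀ t ∈ Set.Ioo a b, ∃ x, P x ∧ t ≤ f x) : ∃ x, P x ∧ b ≤ f x := by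
  obtain ⟨t₀, ht₀⟩ := exists_between hab
  obtain ⟨x₀, hx₀, -⟩ := h t₀ ht₀
  obtain ⟨x, hx, hmax⟩ := {x | P x}.toFinite.exists_maximalFor f _ ⟨x₀, hx₀⟩
  refine ⟨x, hx, not_lt.1 fun hlt => ?_⟩
  obtain ⟨t, ht, htb⟩ := exists_between (max_lt hab hlt)
  obtain ⟨hat, hxt⟩ := max_lt_iff.1 ht
  obtain ⟨y, hy, hty⟩ := h t ⟨hat, htb⟩
  exact (hxt.trans_le hty).not_ge (hmax hy (hxt.trans_le hty).le)

end SubsetSelection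

end RestrictedInvertibility

open RestrictedInvertibility in
theorem theorem1p1 {n m : ℕ} (A : Matrix (Fin n) (Fin m) ℝ) (W : Matrix (Fin m) (Fin m) ℝ)
    (hW : W.IsDiag) (hW0 : ∀ i, W i i ≠ 0)
    (k r : ℕ) (hk : 1 ≤ k) (hkr : k ≤ r) (hr : r ≤ A.rank) :
    ∃ S : Finset (Fin m), S.card = k ∧
      (√(r : ℝ) - √((k : ℝ) - 1)) ^ 2 / frobeniusNorm W⁻¹ ^ 2 *
          ((r : ℝ) / ∑ i ∈ Finset.range r, (singularValue A i ^ 2)⁻¹)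
        ≤ sigmaMin (columns A S * principal W S) ^ 2 := by
  have hk0 : (0 : ℝ) ≤ k - 1 := sub_nonneg.2 (Nat.one_le_cast.2 hk)
  have hr0 : 0 < r := hk.trans hkr
  have : NeZero m := ⟨by have := hr.trans A.rank_le_width; omega⟩
  have hcr : √((k : ℝ) - 1) < √r :=
    Real.sqrt_lt_sqrt hk0 (by have : (k : ℝ) ≤ r := Nat.cast_le.2 hkr; linarith)
  have hZ := frobeniusNorm_inv_sq_pos hW hW0
  have hQ := sum_inv_singularValue_sq_pos hr0.ne' hr
  have := sub_pos.2 hcr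
  refine exists_le_of_forall_mem_Ioo (a := 0) (by positivity) fun t ⟨ht, hlt⟩ => ?_
  obtain ⟨S, hS, hSz⟩ := exists_finset_forall_mul_norm_sq_le A hW hW0 hr (Real.sqrt_nonneg _) hcr
    (by rw [Real.sq_sqrt hk0, sub_add_cancel]) ht hlt
  have : Nonempty S := Finset.card_pos.1 (hS ▸ hk) |>.to_subtype
  exact ⟨S, hS, le_sigmaMin_sq hSz⟩
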